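/- Let $f:\mathbb{C}\to\widehat{\mathbb{C}}=\mathbb{C}\cup\{\infty\}$ be a transcendental (i.e. non-rational) entire or meromorphic function, and for $a\in\widehat{\mathbb{C}}$, $r>0$ let $D_r(a)$ be the open ball with respect to the spherical metric. A point $a\in\widehat{\mathbb{C}}$ is a \emph{Baker omitted value} (bov) of $f$ if $f(z)\neq a$ for all $z\in\mathbb{C}$ and there is $r_0>0$ such that for all $0<r<r_0$ every component of the boundary in $\mathbb{C}$ of $f^{-1}(D_r(a))$ is bounded. A point $b\in\widehat{\mathbb{C}}$ is an \emph{asymptotic value} of $f$ if there is a curve $\gamma:[0,\infty)\to\mathbb{C}$ with $\gamma(t)\to\infty$ and $f(\gamma(t))\to b$ as $t\to\infty$. A \emph{critical point} is a point $z\in\mathbb{C}$ that is not a pole and satisfies $f'(z)=0$, or is a multiple pole; its image is a \emph{critical value}. A \emph{singularity of $f^{-1}$ lies over $b$} if there is a choice of components $U_r$ of $f^{-1}(D_r(b))$, $r>0$, with $U_{r_1}\subset U_{r_2}$ for $r_1<r_2$, such that $\bigcap_{r>0}U_r$ is either empty or consists of exactly one point, which is a critical point. Theorem. Suppose that $a\in\widehat{\mathbb{C}}$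 is a bov of $f$. Then: 1. $a$ is an asymptotic value of $f$, and it is the only one. 2. Every $b\neq a$ over which a singularity of $f^{-1}$ lies is a critical value of $f$. 3. Every $b\neq a$ such that each open neighbourhood $W$ of $b$ has a preimage component $V$ of $f^{-1}(W)$ on which $f$ is not injective lies in the closure in $\widehat{\mathbb{C}}$ of the set of critical values of $f$. 4. $a$ is the only bov of $f$. -/

import Mathlib

open Set Filter Topology

noncomputable section

namespace BakerOmitted

/-- The extended complex plane (Riemann sphere), with its one-point compactification topology. -/
abbrev Sphere : Type := OnePoint ℂ

/-- The chordal distance on the sphere, i.e. the Euclidean distance of the stereographic images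
in the unit sphere of `ℝ³`. -/
def chordalDist : Sphere → Sphere → ℝ
  | .some z, .some w => 2 * ‖z - w‖ / (Real.sqrt (1 + ‖z‖ ^ 2) * Real.sqrt (1 + ‖w‖ ^ 2))
  | .some z, .infty => 2 / Real.sqrt (1 + ‖z‖ ^ 2)
  | .infty, .some w => 2 / Real.sqrt (1 + ‖w‖ ^ 2)
  | .infty, .infty => 0

/-- The spherical (great-circle) distance: the angle subtended by a chord of the unit sphere. -/
def sphericalDist (p q : Sphere) : ℝ := 2 * Real.arcsin (chordalDist p q / 2)

/-- The open ball of centre `a` and radius `r` for the spherical metric. -/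
def sphericalBall (a : Sphere) (r : ℝ) : Set Sphere := {p | sphericalDist p a < r}

/-- `f` is a rational function, i.e. a quotient of two polynomials off the zeros of the
denominator. -/
def IsRational (f : ℂ → ℂ) : Prop :=
  ∃ p q : Polynomial ℂ, q ≠ 0 ∧ ∀ z, q.eval z ≠ 0 → f z = p.eval z / q.eval z

/-- `f` is a transcendental meromorphic function in the plane; entire functions are included.
Mathlib's normal form says that at each point `f` is either analytic or has a pole (where the
complex number `f z` carries no information and is `0` by convention); in particular
there are no artificial values at removable singularities. The actual value at a pole is
restored in `sphereMap`. -/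
def IsTranscendentalMeromorphic (f : ℂ → ℂ) : Prop :=
  MeromorphicNFOn f univ ∧ ¬ IsRational f

open Classical in
/-- A meromorphic function as a map into the sphere, with value `∞` at the poles. -/
def sphereMap (f : ℂ → ℂ) (z : ℂ) : Sphere :=
  if meromorphicOrderAt f z < 0 then OnePoint.infty else (f z : Sphere)

/-- `V` is a connected component of the subset `S` of the plane. -/
def IsComponentOf (V S : Set ℂ) : Prop := ∃ z ∈ S, V = connectedComponentIn S z

/-- `a` is not attained by `f` in the plane. -/
def IsOmittedValue (f : ℂ → ℂ) (a : Sphere) : Prop := ∀ z, sphereMap f z ≠ a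

/-- Baker omitted value: an omitted value such that, for all small `r`, every component of the
boundary (in the plane) of the preimage of the ball of radius `r` around it is bounded. -/
def IsBakerOmittedValue (f : ℂ → ℂ) (a : Sphere) : Prop :=
  IsOmittedValue f a ∧
    ∃ r₀ : ℝ, 0 < r₀ ∧ ∀ r : ℝ, 0 < r → r < r₀ →
      ∀ C : Set ℂ, IsComponentOf C (frontier (sphereMap f ⁻¹' sphericalBall a r)) →
        Bornology.IsBounded C

/-- `b` is the limit of `f` along some curve tending to `∞`. -/
def IsAsymptoticValue (f : ℂ → ℂ) (b : Sphere) : Prop :=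
  ∃ γ : ℝ → ℂ, ContinuousOn γ (Ici 0) ∧ Tendsto γ atTop (cocompact ℂ) ∧
    Tendsto (fun t => sphereMap f (γ t)) atTop (𝓝 b)

/-- A point which is not a pole and where the derivative vanishes, or a multiple pole. -/
def IsCriticalPoint (f : ℂ → ℂ) (z : ℂ) : Prop :=
  (0 ≤ meromorphicOrderAt f z ∧ deriv f z = 0) ∨ meromorphicOrderAt f z ≤ ((-2 : ℤ) : WithTop ℤ)

/-- The image of a critical point. -/
def IsCriticalValue (f : ℂ → ℂ) (b : Sphere) : Prop :=
  ∃ z, IsCriticalPoint f z ∧ sphereMap f z = b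

/-- A choice `r ↦ U r` of components of the preimages of the balls of radius `r` around `b`,
increasing with `r`. -/
def IsNestedChoice (f : ℂ → ℂ) (b : Sphere) (U : ℝ → Set ℂ) : Prop :=
  (∀ r, 0 < r → IsComponentOf (U r) (sphereMap f ⁻¹' sphericalBall b r)) ∧
    ∀ r₁ r₂, 0 < r₁ → r₁ < r₂ → U r₁ ⊆ U r₂

/-- The nested choice `U` shrinks to a critical point. -/
def IsAlgebraicSingularity (f : ℂ → ℂ) (b : Sphere) (U : ℝ → Set ℂ) : Prop :=
  IsNestedChoice f b U ∧ ∃ z, ⋂ r ∈ Ioi (0 : ℝ), U r = {z} ∧ IsCriticalPoint f z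

/-- The nested choice `U` shrinks to the empty set. -/
def IsTranscendentalSingularity (f : ℂ → ℂ) (b : Sphere) (U : ℝ → Set ℂ) : Prop :=
  IsNestedChoice f b U ∧ ⋂ r ∈ Ioi (0 : ℝ), U r = ∅

/-- A singularity of the inverse function, algebraic or transcendental, lies over `b`. -/
def HasSingularityOver (f : ℂ → ℂ) (b : Sphere) : Prop :=
  ∃ U, IsAlgebraicSingularity f b U ∨ IsTranscendentalSingularity f b U

/-- Every open neighbourhood of `b` has a preimage component on which `f` is not injective. -/
def IsSingularByNeighbourhoods (f : ℂ → ℂ) (b : Sphere) : Prop :=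
  ∀ W : Set Sphere, IsOpen W → b ∈ W →
    ∃ V, IsComponentOf V (sphereMap f ⁻¹' W) ∧ ¬ InjOn (sphereMap f) V

end BakerOmitted

end

noncomputable section

namespace BakerOmitted

/-! A rotation of the sphere taking `a` to `∞` turns `f` into a nonconstant entire function `g`, and
small balls about `a` into sets `{R < ‖g‖}` with `R` large. Everything rests on one property,
`BoundedOnlyOnBounded`: a connected set on which `g` is bounded is itself bounded.

Suppose instead that `‖g‖ < R` on a connected unbounded set `S`, where `W = {R < ‖g‖}` has bounded
boundary components. By the maximum principle a component of `W` is unbounded too. A large bounded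
open `N` can be chosen whose frontier misses that of `W`, so `frontier N` splits into relatively
clopen parts, inside `W` and off its closure. From a point `p` of `N` one reaches `∞` along `S`
avoiding the first part, and along the component of `W` avoiding the second. Hence `z - p` has a
continuous logarithm on each part, so on `frontier N`, which is impossible for `p` inside `N`
(Janiszewski).

Consequently preimage components of discs under `g` are bounded. This excludes asymptotic values and
transcendental singularities off `a`, and makes `g` a covering over discs free of critical values,
hence injective there. A curve climbing through the components of `{n < ‖g‖}` shows that `a` is
asymptotic. A second bov would be asymptotic as well, hence equal to `a`. -/

/-! ### Plane topology: bounded open sets whose frontier avoids a closed set with bounded components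
-/

/-- A closed subset of the plane with bounded components has compact relatively open
neighbourhoods of each of its points. -/
theorem exists_isOpen_isCompact_inter {X : Set ℂ} (hX : IsClosed X)
    (hb : ∀ C, IsComponentOf C X → Bornology.IsBounded C) {p : ℂ} (hp : p ∈ X) :
    ∃ O : Set ℂ, IsOpen O ∧ p ∈ O ∧ IsCompact (X ∩ O) := by
  obtain ⟨m, hm⟩ := (hb _ ⟨p, hp, rfl⟩).subset_ball 0
  set Y : Set ℂ := X ∩ Metric.closedBall 0 m
  have hYc : IsCompact Y := (isCompact_closedBall 0 m).inter_left hX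
  have : CompactSpace Y := isCompact_iff_compactSpace.mp hYc
  have hpY : p ∈ Y := ⟨hp, Metric.ball_subset_closedBall (hm (mem_connectedComponentIn hp))⟩
  have hcomp : ∀ x ∈ connectedComponent (⟨p, hpY⟩ : Y), (x : ℂ) ∈ Metric.ball (0 : ℂ) m := by
    intro x hx
    apply hm
    have h1 : IsPreconnected (Subtype.val '' connectedComponent (⟨p, hpY⟩ : Y)) :=
      isPreconnected_connectedComponent.image _ continuous_subtype_val.continuousOn
    refine h1.subset_connectedComponentIn ⟨_, mem_connectedComponent, rfl⟩ ?_ ⟨x, hx, rfl⟩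
    rintro _ ⟨y, -, rfl⟩
    exact y.2.1
  -- In a compact Hausdorff space a component is the intersection of the clopen sets around it, so
  -- by compactness a single clopen set already lies in the open ball. Staying off the bounding
  -- circle, it is relatively open in `X` and not just in `Y`.
  rw [connectedComponent_eq_iInter_isClopen] at hcomp
  have : Nonempty { s : Set Y // IsClopen s ∧ (⟨p, hpY⟩ : Y) ∈ s } := ⟨⟨univ, isClopen_univ, trivial⟩⟩
  obtain ⟨⟨s, hs, hps⟩, hsub⟩ := exists_subset_nhds_of_compactSpace
    (V := fun s : { s : Set Y // IsClopen s ∧ (⟨p, hpY⟩ : Y) ∈ s } => (s : Set Y))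
    (U := Subtype.val ⁻¹' Metric.ball (0 : ℂ) m)
    (fun s t => ⟨⟨s ∩ t, s.2.1.inter t.2.1, s.2.2, t.2.2⟩, inter_subset_left, inter_subset_right⟩)
    (fun s => s.2.1.1)
    (fun x hx => (Metric.isOpen_ball.preimage continuous_subtype_val).mem_nhds (hcomp x hx))
  obtain ⟨O', hO', rfl⟩ := isOpen_induced_iff.mp hs.2
  refine ⟨O' ∩ Metric.ball 0 m, hO'.inter Metric.isOpen_ball, ⟨hps, hsub hps⟩, ?_⟩
  have h2 : IsCompact (Subtype.val '' ((Subtype.val : Y → ℂ) ⁻¹' O')) :=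
    hs.1.isCompact.image continuous_subtype_val
  convert h2 using 1
  ext x
  constructor
  · rintro ⟨h1, h2, h3⟩
    exact ⟨⟨x, h1, Metric.ball_subset_closedBall h3⟩, h2, rfl⟩
  · rintro ⟨y, hy, rfl⟩
    exact ⟨y.2.1, hy, hsub hy⟩

/-- A closed set with bounded components does not meet the boundary of suitable arbitrarily
large bounded open sets. -/
theorem exists_isOpen_isBounded_disjoint_frontier {X : Set ℂ} (hX : IsClosed X)
    (hb : ∀ C, IsComponentOf C X → Bornology.IsBounded C) (n : ℝ) :
    ∃ N : Set ℂ, IsOpen N ∧ Bornology.IsBounded N ∧ Metric.ball 0 n ⊆ N ∧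
      Disjoint (frontier N) X := by
  choose! O hO hpO hc using fun p (hp : p ∈ X) => exists_isOpen_isCompact_inter hX hb hp
  obtain ⟨t, hcov⟩ := ((isCompact_closedBall (0 : ℂ) n).inter_left hX).elim_nhds_subcover'
    (fun p _ => O p) (fun p hp => (hO p hp.1).mem_nhds (hpO p hp.1))
  set Z : Set ℂ := ⋃ p ∈ t, X ∩ O p
  have hZ : IsCompact Z := t.isCompact_biUnion fun p _ => hc p p.2.1
  set Q : Set ℂ := ⋃ p ∈ t, O p
  have hQ : IsOpen Q := isOpen_biUnion fun p _ => hO p p.2.1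
  have hZQ : Z = X ∩ Q := by simp only [Z, Q, inter_iUnion]
  -- `Z` is compact and `X \ Q` is closed and disjoint from it, so some closed thickening of `Z`
  -- meets `X` only inside `Q`, that is, only in `Z`.
  obtain ⟨δ, hδ, hsub⟩ := hZ.exists_cthickening_subset_open (hX.inter hQ.isClosed_compl).isOpen_compl
    (by rw [hZQ]; rintro x ⟨hx, hx'⟩ ⟨-, h⟩; exact h hx')
  refine ⟨Metric.ball 0 n ∪ Metric.thickening δ Z, Metric.isOpen_ball.union Metric.isOpen_thickening,
    Metric.isBounded_ball.union hZ.isBounded.thickening, subset_union_left, ?_⟩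
  rw [Set.disjoint_left]
  intro x hx hxX
  rw [(Metric.isOpen_ball.union Metric.isOpen_thickening).frontier_eq, closure_union] at hx
  have hxZ : x ∉ Z := fun h => hx.2 (Or.inr (Metric.self_subset_thickening hδ Z h))
  have hxQ : x ∉ Q := fun h => hxZ (hZQ ▸ ⟨hxX, h⟩)
  rcases hx.1 with h | h
  · exact hxQ (hcov ⟨hxX, Metric.closure_ball_subset_closedBall h⟩)
  · exact hsub (Metric.closure_thickening_subset_cthickening _ _ h) ⟨hxX, hxQ⟩

/-! ### Continuous logarithms and Janiszewski's theorem -/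

/-- There is a continuous branch of the logarithm of `z - p` on `K`. -/
def HasLogBranch (K : Set ℂ) (p : ℂ) : Prop :=
  ∃ L : ℂ → ℂ, ContinuousOn L K ∧ ∀ z ∈ K, Complex.exp (L z) = z - p

theorem one_sub_mem_slitPlane {u : ℂ} (hu : ‖u‖ < 1) : 1 - u ∈ Complex.slitPlane := by
  rw [sub_eq_add_neg]
  exact Complex.mem_slitPlane_of_norm_lt_one (by rwa [norm_neg])

/-- Write `z - q = (z - p) * (1 - (q - p) / (z - p))`; the second factor is within distance `1` of
`1`, so the principal logarithm applies to it. The next lemma divides by the same factor. -/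
theorem hasLogBranch_of_ratio {K : Set ℂ} {p q : ℂ} (h : HasLogBranch K p) (hp : p ∉ K)
    (hr : ∀ z ∈ K, ‖(q - p) / (z - p)‖ < 1) : HasLogBranch K q := by
  obtain ⟨L, hL, hexp⟩ := h
  have hne : ∀ z ∈ K, z - p ≠ 0 := fun z hz => sub_ne_zero.mpr fun h => hp (h ▸ hz)
  refine ⟨fun z => L z + Complex.log (1 - (q - p) / (z - p)), hL.add ?_, fun z hz => ?_⟩
  · refine ContinuousOn.clog ?_ fun z hz => one_sub_mem_slitPlane (hr z hz)
    exact continuousOn_const.sub (continuousOn_const.div (by fun_prop) hne)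
  · have h1 := Complex.slitPlane_ne_zero (one_sub_mem_slitPlane (hr z hz))
    rw [Complex.exp_add, hexp z hz, Complex.exp_log h1]
    have := hne z hz
    field_simp
    ring

theorem hasLogBranch_of_ratio' {K : Set ℂ} {p q : ℂ} (h : HasLogBranch K q) (hp : p ∉ K)
    (hr : ∀ z ∈ K, ‖(q - p) / (z - p)‖ < 1) : HasLogBranch K p := by
  obtain ⟨L, hL, hexp⟩ := h
  have hne : ∀ z ∈ K, z - p ≠ 0 := fun z hz => sub_ne_zero.mpr fun h => hp (h ▸ hz)
  refine ⟨fun z => L z - Complex.log (1 - (q - p) / (z - p)), hL.sub ?_, fun z hz => ?_⟩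
  · refine ContinuousOn.clog ?_ fun z hz => one_sub_mem_slitPlane (hr z hz)
    exact continuousOn_const.sub (continuousOn_const.div (by fun_prop) hne)
  · have h1 := Complex.slitPlane_ne_zero (one_sub_mem_slitPlane (hr z hz))
    rw [Complex.exp_sub, hexp z hz, Complex.exp_log h1, div_eq_iff h1]
    have := hne z hz
    field_simp
    ring

/-- Here `z - q = -q * (1 - z / q)` with `‖z / q‖ < 1`. -/
theorem hasLogBranch_of_norm_lt {K : Set ℂ} {M : ℝ} {q : ℂ} (hK : ∀ z ∈ K, ‖z‖ ≤ M) (hM : 0 ≤ M)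
    (hq : M < ‖q‖) : HasLogBranch K q := by
  have hq0 : q ≠ 0 := norm_pos_iff.mp (hM.trans_lt hq)
  have hr : ∀ z ∈ K, ‖z / q‖ < 1 := fun z hz => by
    rw [norm_div, div_lt_one (hM.trans_lt hq)]
    exact (hK z hz).trans_lt hq
  refine ⟨fun z => Complex.log (-q) + Complex.log (1 - z / q), continuousOn_const.add ?_,
    fun z hz => ?_⟩
  · exact ContinuousOn.clog (by fun_prop) fun z hz => one_sub_mem_slitPlane (hr z hz)
  · rw [Complex.exp_add, Complex.exp_log (neg_ne_zero.mpr hq0),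
      Complex.exp_log (Complex.slitPlane_ne_zero (one_sub_mem_slitPlane (hr z hz)))]
    field_simp
    ring

/-- Points of a connected unbounded set that avoids the compact set `K` admit logarithms. -/
theorem hasLogBranch_of_isPreconnected {K S : Set ℂ} (hK : IsCompact K) (hS : IsPreconnected S)
    (hSu : ¬ Bornology.IsBounded S) (hd : Disjoint S K) {p : ℂ} (hp : p ∈ S) :
    HasLogBranch K p := by
  obtain ⟨M, hM0, hM⟩ := hK.isBounded.exists_pos_norm_le
  obtain ⟨q, hqS, hq⟩ : ∃ q ∈ S, M < ‖q‖ := by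
    by_contra! h
    exact hSu (isBounded_iff_forall_norm_le.mpr ⟨M, h⟩)
  -- Having a logarithm is locally constant in the base point off `K`, so it propagates along `S`
  -- from a far point `q`.
  refine (hS.induction₂ (fun x y => HasLogBranch K x ↔ HasLogBranch K y) (fun x hx => ?_)
    (fun x y z _ _ _ h1 h2 => h1.trans h2) (fun x y _ _ h => h.symm) hp hqS).mpr
    (hasLogBranch_of_norm_lt hM hM0.le hq)
  have hxK : x ∉ K := disjoint_left.mp hd hx
  obtain ⟨ε, hε, hball⟩ := Metric.isOpen_iff.mp hK.isClosed.isOpen_compl x hxK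
  filter_upwards [nhdsWithin_le_nhds (Metric.ball_mem_nhds x hε)] with y hy
  have hr : ∀ z ∈ K, ‖(y - x) / (z - x)‖ < 1 := by
    intro z hz
    have h1 : ε ≤ ‖z - x‖ := by
      by_contra! h
      exact hball (mem_ball_iff_norm.mpr h) hz
    rw [norm_div, div_lt_one (hε.trans_le h1)]
    exact (mem_ball_iff_norm.mp hy).trans_le h1
  exact ⟨fun h => hasLogBranch_of_ratio h hxK hr, fun h => hasLogBranch_of_ratio' h hxK hr⟩

/-- There is no continuous logarithm of `z - p` on a circle around `p`. -/
theorem not_exists_log_circle (p : ℂ) {ρ : ℝ} (l : ℂ → ℂ) (hl : Continuous l)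
    (h : ∀ z, ‖z - p‖ = ρ → Complex.exp (l z) = z - p) (hρ : 0 < ρ) : False := by
  set u : ℝ → ℂ := fun θ => l (p + ρ * Complex.exp (θ * Complex.I))
  set v : ℝ → ℂ := fun θ => l (p + ρ) + θ * Complex.I
  have hu : Continuous u := by fun_prop
  have hv : Continuous v := by fun_prop
  have hexpu : ∀ θ : ℝ, Complex.exp (u θ) = ρ * Complex.exp (θ * Complex.I) := fun θ => by
    rw [h _ (by simp [Complex.norm_exp_ofReal_mul_I, abs_of_pos hρ])]
    ring
  have hexpv : ∀ θ : ℝ, Complex.exp (v θ) = ρ * Complex.exp (θ * Complex.I) := fun θ => by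
    rw [Complex.exp_add, h _ (by simp [abs_of_pos hρ])]
    ring
  -- Both are lifts of one loop through `exp` with the same start; but `u` is periodic while `v`
  -- gains `2πi` in one turn.
  have huv : u = v := by
    refine Complex.isCoveringMap_exp.eq_of_comp_eq hu hv ?_ 0 (by simp [u, v])
    ext θ
    simp [hexpu, hexpv]
  have h1 := congrFun huv (2 * Real.pi)
  simp only [u, v] at h1
  push_cast at h1
  rw [Complex.exp_two_pi_mul_I, mul_one, left_eq_add] at h1
  simp [Real.pi_ne_zero] at h1

/-- The boundary of a bounded set does not admit a logarithm of `z - p` for `p` inside. -/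
theorem not_hasLogBranch_frontier {N : Set ℂ} (hN : Bornology.IsBounded N)
    {p : ℂ} (hp : p ∈ N) : ¬ HasLogBranch (frontier N) p := by
  rintro ⟨L, hL, hexp⟩
  obtain ⟨L', hL'⟩ := ContinuousMap.exists_restrict_eq isClosed_frontier
    (⟨_, hL.domRestrict⟩ : C(frontier N, ℂ))
  have hL'' : ∀ z ∈ frontier N, Complex.exp (L' z) = z - p := fun z hz => by
    rw [← hexp z hz]
    exact congrArg Complex.exp (DFunLike.congr_fun hL' ⟨z, hz⟩)
  classical
  -- With `L'` the Tietze extension of `L`, this is continuous and zero-free on the plane, so it has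
  -- a global logarithm. On a large circle it equals `z - p`, a contradiction.
  set h : ℂ → ℂ := fun z => if z ∈ N then Complex.exp (L' z) else z - p
  have hc : Continuous h := Continuous.if (fun z hz => hL'' z hz) (by fun_prop) (by fun_prop)
  have h0 : ∀ z, h z ≠ 0 := fun z => by
    by_cases hz : z ∈ N
    · simp [h, hz]
    · simp only [h, hz, if_false]
      exact sub_ne_zero.mpr fun e => hz (e ▸ hp)
  obtain ⟨l, ⟨-, hl⟩, -⟩ := Complex.isCoveringMapOn_exp.existsUnique_continuousMap_lifts
    (⟨h, hc⟩ : C(ℂ, ℂ)) (a₀ := 0) (e₀ := Complex.log (h 0)) (Complex.exp_log (h0 0)) h0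
  obtain ⟨ρ, hρ⟩ := hN.subset_ball p
  refine not_exists_log_circle p l l.continuous (ρ := ρ) (fun z hz => ?_)
    (Metric.pos_of_mem_ball (hρ hp))
  have hzN : z ∉ N := fun hzN => (mem_ball_iff_norm.mp (hρ hzN)).ne hz
  have := congrFun hl z
  simpa [h, hzN] using this

/-- **Janiszewski's theorem**, in the form needed here. -/
theorem false_of_frontier_subset_union {N U W S T : Set ℂ}
    (hNb : Bornology.IsBounded N) (hU : IsOpen U) (hW : IsOpen W) (hUW : Disjoint U W)
    (hfr : frontier N ⊆ U ∪ W) (hS : IsPreconnected S) (hT : IsPreconnected T)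
    (hSu : ¬ Bornology.IsBounded S) (hTu : ¬ Bornology.IsBounded T)
    (hSW : Disjoint S (frontier N ∩ W)) (hTU : Disjoint T (frontier N ∩ U))
    {p : ℂ} (hp : p ∈ N) (hpS : p ∈ S) (hpT : p ∈ T) : False := by
  have hcpt : IsCompact (frontier N) :=
    Metric.isCompact_of_isClosed_isBounded isClosed_frontier (hNb.closure.subset frontier_subset_closure)
  have e1 : frontier N ∩ W = frontier N ∩ Uᶜ := by
    ext x
    constructor
    · rintro ⟨h1, h2⟩
      exact ⟨h1, fun h => disjoint_left.mp hUW h h2⟩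
    · rintro ⟨h1, h2⟩
      exact ⟨h1, (hfr h1).resolve_left h2⟩
  have e2 : frontier N ∩ U = frontier N ∩ Wᶜ := by
    ext x
    constructor
    · rintro ⟨h1, h2⟩
      exact ⟨h1, fun h => disjoint_left.mp hUW h2 h⟩
    · rintro ⟨h1, h2⟩
      exact ⟨h1, (hfr h1).resolve_right h2⟩
  obtain ⟨L₁, hL₁, hexp₁⟩ := hasLogBranch_of_isPreconnected
    (e1 ▸ hcpt.inter_right hU.isClosed_compl) hS hSu hSW hpS
  obtain ⟨L₂, hL₂, hexp₂⟩ := hasLogBranch_of_isPreconnected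
    (e2 ▸ hcpt.inter_right hW.isClosed_compl) hT hTu hTU hpT
  classical
  -- The two pieces are relatively open and disjoint, so their logarithms glue without any
  -- compatibility condition.
  refine not_hasLogBranch_frontier hNb hp ⟨fun z => if z ∈ U then L₂ z else L₁ z, ?_, ?_⟩
  · intro z hz
    rcases hfr hz with h | h
    · have : ContinuousWithinAt L₂ (frontier N) z :=
        (hL₂ z ⟨hz, h⟩).mono_of_mem_nhdsWithin
          (inter_mem self_mem_nhdsWithin (mem_nhdsWithin_of_mem_nhds (hU.mem_nhds h)))
      refine this.congr_of_eventuallyEq ?_ (by simp [h])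
      filter_upwards [mem_nhdsWithin_of_mem_nhds (hU.mem_nhds h)] with y hy
      simp [hy]
    · have : ContinuousWithinAt L₁ (frontier N) z :=
        (hL₁ z ⟨hz, h⟩).mono_of_mem_nhdsWithin
          (inter_mem self_mem_nhdsWithin (mem_nhdsWithin_of_mem_nhds (hW.mem_nhds h)))
      refine this.congr_of_eventuallyEq ?_ (by simp [disjoint_right.mp hUW h])
      filter_upwards [mem_nhdsWithin_of_mem_nhds (hW.mem_nhds h)] with y hy
      simp [disjoint_right.mp hUW hy]
  · intro z hz
    rcases hfr hz with h | h
    · simpa [h] using hexp₂ z ⟨hz, h⟩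
    · simpa [disjoint_right.mp hUW h] using hexp₁ z ⟨hz, h⟩

/-! ### Entire functions bounded only on bounded connected sets -/

section

theorem IsComponentOf.subset {V S : Set ℂ} (h : IsComponentOf V S) : V ⊆ S := by
  obtain ⟨z, -, rfl⟩ := h
  exact connectedComponentIn_subset S z

theorem IsComponentOf.isPreconnected {V S : Set ℂ} (h : IsComponentOf V S) : IsPreconnected V := by
  obtain ⟨z, -, rfl⟩ := h
  exact isPreconnected_connectedComponentIn

theorem IsComponentOf.nonempty {V S : Set ℂ} (h : IsComponentOf V S) : V.Nonempty := by
  obtain ⟨z, hz, rfl⟩ := h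
  exact ⟨z, mem_connectedComponentIn hz⟩

theorem IsComponentOf.isOpen {V S : Set ℂ} (h : IsComponentOf V S) (hS : IsOpen S) : IsOpen V := by
  obtain ⟨z, -, rfl⟩ := h
  exact hS.connectedComponentIn

/-- Components are relatively closed. -/
theorem IsComponentOf.closure_inter_subset {V S : Set ℂ} (h : IsComponentOf V S) :
    closure V ∩ S ⊆ V := by
  rintro p ⟨hp, hpS⟩
  have hV := h.isPreconnected
  have hVS := h.subset
  obtain ⟨z, hz, rfl⟩ := h
  have h1 : IsPreconnected (insert p (connectedComponentIn S z)) :=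
    hV.subset_closure (subset_insert _ _) (insert_subset hp subset_closure)
  exact h1.subset_connectedComponentIn (mem_insert_of_mem _ (mem_connectedComponentIn hz))
    (insert_subset hpS hVS) (mem_insert _ _)

variable {g : ℂ → ℂ}

theorem isOpen_lt_norm (hg : Continuous g) (r : ℝ) : IsOpen {z | r < ‖g z‖} :=
  isOpen_lt continuous_const hg.norm

/-- The maximum principle: components of `{r < ‖g‖}` are unbounded. -/
theorem not_isBounded_component_lt_norm (hg : Differentiable ℂ g) {r : ℝ} {V : Set ℂ}
    (hV : IsComponentOf V {z | r < ‖g z‖}) : ¬ Bornology.IsBounded V := by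
  intro hb
  obtain ⟨z, hz⟩ := hV.nonempty
  refine (show r < ‖g z‖ from hV.subset hz).not_ge ?_
  refine Complex.norm_le_of_forall_mem_frontier_norm_le hb hg.diffContOnCl (fun w hw => ?_)
    (subset_closure hz)
  rw [(hV.isOpen (isOpen_lt_norm hg.continuous r)).frontier_eq] at hw
  by_contra! h
  exact hw.2 (hV.closure_inter_subset ⟨hw.1, h⟩)

theorem exists_lt_norm (hg : Differentiable ℂ g) (hc : ¬ ∃ c, ∀ z, g z = c) (r : ℝ) :
    ∃ z, r < ‖g z‖ := by
  by_contra! h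
  refine hc ⟨g 0, fun z => hg.apply_eq_apply_of_bounded ?_ z 0⟩
  exact isBounded_iff_forall_norm_le.mpr ⟨r, forall_mem_range.mpr h⟩

/-- If the boundary components of `{R < ‖g‖}` are bounded, so are the connected subsets
of `{‖g‖ < R}`. -/
theorem isBounded_of_norm_lt_of_components (hg : Differentiable ℂ g) (hc : ¬ ∃ c, ∀ z, g z = c)
    {R : ℝ} (hb : ∀ C, IsComponentOf C (frontier {z | R < ‖g z‖}) → Bornology.IsBounded C)
    {S : Set ℂ} (hS : IsPreconnected S) (hSR : ∀ z ∈ S, ‖g z‖ < R) : Bornology.IsBounded S := by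
  by_contra hSu
  obtain ⟨p, hp⟩ : S.Nonempty := nonempty_iff_ne_empty.mpr fun h => hSu (h ▸ Bornology.isBounded_empty)
  obtain ⟨q, hq⟩ := exists_lt_norm hg hc R
  set W : Set ℂ := {z | R < ‖g z‖}
  have hW : IsOpen W := isOpen_lt_norm hg.continuous R
  have hV : IsComponentOf (connectedComponentIn W q) W := ⟨q, hq, rfl⟩
  have hqV : q ∈ connectedComponentIn W q := mem_connectedComponentIn hq
  set n : ℝ := ‖p‖ + ‖q‖ + 1
  obtain ⟨N, hNo, hNb, hBN, hd⟩ := exists_isOpen_isBounded_disjoint_frontier isClosed_frontier hb n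
  have hpB : p ∈ Metric.ball (0 : ℂ) n := by
    rw [mem_ball_zero_iff]
    have := norm_nonneg q
    simp only [n]; linarith
  have hqB : q ∈ Metric.ball (0 : ℂ) n := by
    rw [mem_ball_zero_iff]
    have := norm_nonneg p
    simp only [n]; linarith
  have hB : IsPreconnected (Metric.ball (0 : ℂ) n) := (convex_ball _ _).isPreconnected
  have hBfr : ∀ z ∈ Metric.ball (0 : ℂ) n, z ∉ frontier N := fun z hz h =>
    (hNo.frontier_eq ▸ h).2 (hBN hz)
  -- The ball, which lies in `N` and so misses its frontier, joins `S` and the component of `W` to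
  -- the common point `p`.
  refine false_of_frontier_subset_union (N := N) (U := (closure W)ᶜ) (W := W)
    (S := Metric.ball 0 n ∪ S) (T := Metric.ball 0 n ∪ connectedComponentIn W q) hNb
    isClosed_closure.isOpen_compl hW (disjoint_compl_left.mono_right subset_closure) ?_
    (hB.union p hpB hp hS) (hB.union q hqB hqV hV.isPreconnected)
    (fun h => hSu (h.subset subset_union_right))
    (fun h => not_isBounded_component_lt_norm hg hV (h.subset subset_union_right))
    ?_ ?_ (hBN hpB) (Or.inl hpB) (Or.inl hpB)
  · intro z hz
    by_contra! h
    simp only [mem_union, mem_compl_iff, not_or, not_not] at h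
    exact disjoint_left.mp hd hz (hW.frontier_eq ▸ h)
  · rw [disjoint_left]
    rintro z (h | h) ⟨h1, h2⟩
    · exact hBfr z h h1
    · exact (hSR z h).not_gt h2
  · rw [disjoint_left]
    rintro z (h | h) ⟨h1, h2⟩
    · exact hBfr z h h1
    · exact h2 (subset_closure (hV.subset h))

/-- Every connected set on which `g` is bounded is itself bounded. -/
def BoundedOnlyOnBounded (g : ℂ → ℂ) : Prop :=
  ∀ (R : ℝ) (S : Set ℂ), IsPreconnected S → (∀ z ∈ S, ‖g z‖ < R) → Bornology.IsBounded S

theorem boundedOnlyOnBounded (hg : Differentiable ℂ g) (hc : ¬ ∃ c, ∀ z, g z = c) {R₀ : ℝ}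
    (hb : ∀ R, R₀ < R → ∀ C, IsComponentOf C (frontier {z | R < ‖g z‖}) → Bornology.IsBounded C) :
    BoundedOnlyOnBounded g := fun R _ hS hSR =>
  isBounded_of_norm_lt_of_components hg hc (hb (max R (R₀ + 1)) (by simp)) hS
    fun z hz => (hSR z hz).trans_le (le_max_left _ _)

/-- Otherwise `g` would be bounded on `V`, making `V` bounded, against the maximum principle. This
lets the asymptotic curve climb from level `n` to level `n + 1` inside one component. -/
theorem BoundedOnlyOnBounded.exists_lt_norm_of_component (hB : BoundedOnlyOnBounded g)
    (hg : Differentiable ℂ g) {r : ℝ} {V : Set ℂ} (hV : IsComponentOf V {z | r < ‖g z‖}) (M : ℝ) :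
    ∃ z ∈ V, M < ‖g z‖ := by
  by_contra! h
  exact not_isBounded_component_lt_norm hg hV
    (hB (M + 1) V hV.isPreconnected fun z hz => (h z hz).trans_lt (lt_add_one M))

/-- Concatenation of countably many paths. -/
theorem exists_continuous_concatenation {z : ℕ → ℂ} {P : ℕ → Set ℂ}
    (h : ∀ n, JoinedIn (P n) (z n) (z (n + 1))) :
    ∃ γ : ℝ → ℂ, Continuous γ ∧ ∀ t, 0 ≤ t → γ t ∈ P ⌊t⌋₊ := by
  set p : ∀ n, Path (z n) (z (n + 1)) := fun n => (h n).somePath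
  set γ : ℝ → ℂ := fun t => (p ⌊t⌋₊).extend (t - ⌊t⌋₊)
  -- The `k`-th increment vanishes before time `k` and is constant after `k + 1`, so this visibly
  -- continuous sum telescopes to the first `N` paths run in succession.
  set s : ℕ → ℝ → ℂ := fun N t => z 0 + ∑ k ∈ Finset.range N, ((p k).extend (t - k) - z k)
  have hs : ∀ N, Continuous (s N) := fun N => by
    refine continuous_const.add (continuous_finsetSum _ fun k _ => ?_)
    exact ((p k).continuous_extend.comp (by fun_prop)).sub continuous_const
  have key : ∀ N : ℕ, (∀ t : ℝ, N ≤ t → s N t = z N) ∧ ∀ t : ℝ, 0 ≤ t → t < N → s N t = γ t := by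
    intro N
    induction N with
    | zero => exact ⟨fun t _ => by simp [s], fun t h0 h1 => absurd h1 (by simpa using h0)⟩
    | succ N ih =>
      have hstep : ∀ t, s (N + 1) t = s N t + ((p N).extend (t - N) - z N) := fun t => by
        simp only [s, Finset.sum_range_succ, add_assoc]
      refine ⟨fun t ht => ?_, fun t h0 ht => ?_⟩
      · push_cast at ht
        rw [hstep, ih.1 t (by linarith), (p N).extend_of_one_le (by linarith)]
        ring
      · push_cast at ht
        rcases lt_or_ge t N with h1 | h1
        · rw [hstep, ih.2 t h0 h1, (p N).extend_of_le_zero (by linarith)]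
          ring
        · have : ⌊t⌋₊ = N := (Nat.floor_eq_iff h0).mpr ⟨h1, ht⟩
          rw [hstep, ih.1 t h1]
          simp only [γ]
          rw [this]
          ring
  refine ⟨fun t => γ (max t 0), ?_, fun t ht => ?_⟩
  · rw [continuous_iff_continuousAt]
    intro t
    obtain ⟨N, hN⟩ := exists_nat_gt (max t 0)
    have hc : Continuous fun t : ℝ => s N (max t 0) := (hs N).comp (by fun_prop)
    refine hc.continuousAt.congr ?_
    have ho : IsOpen {t : ℝ | max t 0 < N} := isOpen_lt (by fun_prop) continuous_const
    filter_upwards [ho.mem_nhds hN] with t ht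
    exact (key N).2 _ (le_max_right _ _) ht
  · simp only [max_eq_left ht, γ]
    rw [Path.extend_apply _ ⟨sub_nonneg.mpr (Nat.floor_le ht), by linarith [Nat.lt_floor_add_one t]⟩]
    exact (h _).somePath_mem _

/-- A curve along which `g` tends to infinity. -/
theorem BoundedOnlyOnBounded.exists_curve (hB : BoundedOnlyOnBounded g) (hg : Differentiable ℂ g)
    (hc : ¬ ∃ c, ∀ z, g z = c) :
    ∃ γ : ℝ → ℂ, Continuous γ ∧ Tendsto γ atTop (cocompact ℂ) ∧
      Tendsto (fun t => g (γ t)) atTop (cocompact ℂ) := by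
  have step : ∀ (n : ℕ) (z : {z : ℂ // (n : ℝ) < ‖g z‖}),
      ∃ w : {z : ℂ // ((n + 1 : ℕ) : ℝ) < ‖g z‖}, JoinedIn {z | (n : ℝ) < ‖g z‖} z w := by
    rintro n ⟨z, hz⟩
    have hV : IsComponentOf (connectedComponentIn {z | (n : ℝ) < ‖g z‖} z) {z | (n : ℝ) < ‖g z‖} :=
      ⟨z, hz, rfl⟩
    obtain ⟨w, hw, hw'⟩ := hB.exists_lt_norm_of_component hg hV (n + 1 : ℕ)
    have hpc : IsPathConnected (connectedComponentIn {z | (n : ℝ) < ‖g z‖} z) :=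
      (hV.isOpen (isOpen_lt_norm hg.continuous n)).isConnected_iff_isPathConnected.mp
        ⟨hV.nonempty, hV.isPreconnected⟩
    exact ⟨⟨w, hw'⟩, (hpc.joinedIn _ (mem_connectedComponentIn hz) _ hw).mono hV.subset⟩
  choose next hnext using step
  obtain ⟨z₀, hz₀⟩ := exists_lt_norm hg hc 0
  set z : ∀ n : ℕ, {z : ℂ // (n : ℝ) < ‖g z‖} :=
    fun n => Nat.rec ⟨z₀, by simpa using hz₀⟩ (fun n z => next n z) n
  obtain ⟨γ, hγ, hmem⟩ := exists_continuous_concatenation (z := fun n => (z n : ℂ))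
    (P := fun n => {z | (n : ℝ) < ‖g z‖}) (fun n => hnext n (z n))
  have hlim : Tendsto (fun t => ‖g (γ t)‖) atTop atTop := by
    refine tendsto_atTop_mono' _ ?_ (tendsto_natCast_atTop_atTop.comp (tendsto_nat_floor_atTop (α := ℝ)))
    filter_upwards [eventually_ge_atTop 0] with t ht
    exact (hmem t ht).le
  have hlim' : Tendsto (fun t => g (γ t)) atTop (cocompact ℂ) := by
    rw [← Metric.cobounded_eq_cocompact, ← comap_norm_atTop]
    exact tendsto_comap_iff.mpr hlim
  refine ⟨γ, hγ, ?_, hlim'⟩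
  rw [hasBasis_cocompact.tendsto_right_iff]
  intro K hK
  have := hlim'.eventually (hK.image hg.continuous).compl_mem_cocompact
  filter_upwards [this] with t ht h
  exact ht ⟨_, h, rfl⟩

/-- A bounded component of the preimage of a disc without critical values is mapped injectively. -/
theorem injOn_of_component_ball (hg : Differentiable ℂ g) {β : ℂ} {ε : ℝ} {V : Set ℂ}
    (hV : IsComponentOf V (g ⁻¹' Metric.ball β ε)) (hb : Bornology.IsBounded V)
    (hcrit : ∀ z ∈ V, deriv g z ≠ 0) : InjOn g V := by
  have hS : IsOpen (g ⁻¹' Metric.ball β ε) := Metric.isOpen_ball.preimage hg.continuous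
  have hVo := hV.isOpen hS
  have : CompactSpace (closure V) := isCompact_iff_compactSpace.mp hb.isCompact_closure
  set G : closure V → ℂ := fun e => g e
  have hG : Continuous G := hg.continuous.comp continuous_subtype_val
  have hmemV : ∀ e : closure V, G e ∈ Metric.ball β ε → (e : ℂ) ∈ V := fun e he =>
    hV.closure_inter_subset ⟨e.2, he⟩
  -- Passing to the compact `closure V` adds no points over the disc, so a local homeomorphism there
  -- is already a covering.
  have hloc : IsLocalHomeomorphOn G (G ⁻¹' Metric.ball β ε) := by
    rw [isLocalHomeomorphOn_iff_isOpenEmbedding_restrict]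
    intro e he
    have hstrict : HasStrictDerivAt g (deriv g e) e :=
      (hg.analyticAt e).hasStrictDerivAt
    set φ := hstrict.hasStrictFDerivAt_equiv (hcrit e (hmemV e he)) |>.toOpenPartialHomeomorph g
    have hφe : (e : ℂ) ∈ φ.source :=
      (hstrict.hasStrictFDerivAt_equiv (hcrit e (hmemV e he))).mem_toOpenPartialHomeomorph_source
    have hφ : ∀ z, φ z = g z := fun z => rfl
    refine ⟨Subtype.val ⁻¹' (V ∩ φ.source), (((hVo.inter φ.open_source).preimage
      continuous_subtype_val).mem_nhds ⟨hmemV e he, hφe⟩), ?_⟩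
    refine IsOpenEmbedding.of_continuous_injective_isOpenMap ?_ ?_ ?_
    · exact hG.comp continuous_subtype_val
    · intro x y hxy
      exact Subtype.ext (Subtype.ext (φ.injOn x.2.2 y.2.2 hxy))
    · intro O hO
      obtain ⟨O₁, hO₁, rfl⟩ := isOpen_induced_iff.mp hO
      obtain ⟨O₂, hO₂, rfl⟩ := isOpen_induced_iff.mp hO₁
      convert φ.isOpen_image_of_subset_source (s := (V ∩ φ.source) ∩ O₂)
        ((hVo.inter φ.open_source).inter hO₂) (fun x hx => hx.1.2) using 1
      ext w
      constructor
      · rintro ⟨x, hx, rfl⟩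
        exact ⟨_, ⟨x.2, hx⟩, rfl⟩
      · rintro ⟨x, ⟨hx, hx'⟩, rfl⟩
        exact ⟨⟨⟨x, subset_closure hx.1⟩, hx⟩, hx', rfl⟩
  have hcov : IsCoveringMapOn G (Metric.ball β ε) := IsCoveringMapOn.of_isLocalHomeomorphOn hG hloc
  intro p hp q hq hpq
  have hpB : g p ∈ Metric.ball β ε := hV.subset hp
  have : ContractibleSpace (Metric.ball β ε) :=
    (convex_ball β ε).contractibleSpace ⟨_, hpB⟩
  have : LocallyPathConnectedSpace (Metric.ball β ε) :=
    Metric.isOpen_ball.locallyPathConnectedSpace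
  obtain ⟨F, ⟨hF0, hF⟩, -⟩ := hcov.existsUnique_continuousMap_lifts
    (⟨Subtype.val, continuous_subtype_val⟩ : C(Metric.ball β ε, ℂ)) (a₀ := ⟨g p, hpB⟩)
    (e₀ := ⟨p, subset_closure hp⟩) rfl (fun a => a.2)
  have hFg : ∀ w : Metric.ball β ε, g (F w) = w := fun w => congrFun hF w
  have hVB : ∀ x : V, g x ∈ Metric.ball β ε := fun x => hV.subset x.2
  have : PreconnectedSpace V := isPreconnected_iff_preconnectedSpace.mp hV.isPreconnected
  have hgF : ∀ x : V, G (F ⟨g x, hVB x⟩) = g x := fun x => hFg ⟨g x, hVB x⟩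
  have hFc : Continuous fun x : V => F ⟨g x, hVB x⟩ :=
    F.continuous.comp ((hg.continuous.comp continuous_subtype_val).subtype_mk hVB)
  have hm : ∀ x : V, F ⟨g x, hVB x⟩ ∈ G ⁻¹' Metric.ball β ε := fun x => by
    rw [mem_preimage, hgF x]
    exact hVB x
  -- `F` is the section over the disc through `p`. On the connected set `V`, `F ∘ g` and the
  -- inclusion lift the same map and agree at `p`, so `F` inverts `g` on `V`.
  have heq := hcov.isCoveringMap_restrictPreimage.eq_of_comp_eq
    (g₁ := fun x : V => ⟨F ⟨g x, hVB x⟩, hm x⟩)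
    (g₂ := fun x : V => ⟨⟨x, subset_closure x.2⟩, hVB x⟩)
    (hFc.subtype_mk hm)
    ((continuous_subtype_val.subtype_mk fun x => subset_closure x.2).subtype_mk hVB)
    (funext fun x => Subtype.ext (hgF x)) ⟨p, hp⟩ (Subtype.ext hF0)
  have hq' : (F ⟨g q, hV.subset hq⟩ : ℂ) = q :=
    congrArg (fun e => ((e : closure V) : ℂ)) (congrArg Subtype.val (congrFun heq ⟨q, hq⟩))
  have e : (⟨g p, hpB⟩ : Metric.ball β ε) = ⟨g q, hV.subset hq⟩ := Subtype.ext hpq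
  exact (congrArg Subtype.val hF0).symm.trans ((congrArg (fun w => (F w : ℂ)) e).trans hq')

end

/-! ### Rotations of the sphere and the spherical metric -/

open scoped ComplexConjugate

open Classical in
/-- The rotation `w ↦ (1 + a w) / (w - conj a)` of the sphere, which takes `∞` to `a`. -/
def rotation (a : ℂ) : Sphere → Sphere
  | .some w => if w = conj a then OnePoint.infty else
      ((a + (1 + a * conj a) * (w - conj a)⁻¹ : ℂ) : Sphere)
  | .infty => a

theorem rotation_infty (a : ℂ) : rotation a OnePoint.infty = a := rfl

theorem rotation_conj (a : ℂ) : rotation a (conj a : ℂ) = OnePoint.infty := if_pos rfl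

theorem rotation_coe {a w : ℂ} (h : w ≠ conj a) :
    rotation a w = ((a + (1 + a * conj a) * (w - conj a)⁻¹ : ℂ) : Sphere) := if_neg h

theorem one_add_mul_conj_ne_zero (a : ℂ) : 1 + a * conj a ≠ 0 := by
  rw [Complex.mul_conj, ← Complex.ofReal_one, ← Complex.ofReal_add, Complex.ofReal_ne_zero]
  have := Complex.normSq_nonneg a
  positivity

theorem rotation_rotation (a : ℂ) (p : Sphere) : rotation (conj a) (rotation a p) = p := by
  have hk := one_add_mul_conj_ne_zero a
  induction p using OnePoint.rec with
  | infty => rw [rotation_infty]; simpa using rotation_conj (conj a)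
  | coe w =>
    by_cases h : w = conj a
    · rw [h, rotation_conj, rotation_infty]
    · have h' := sub_ne_zero.mpr h
      rw [rotation_coe h, rotation_coe]
      · congr 1
        rw [Complex.conj_conj, add_sub_cancel_left, mul_comm (conj a) a, mul_inv, inv_inv,
          mul_inv_cancel_left₀ hk, add_sub_cancel]
      · simp [hk, h']

theorem continuous_rotation (a : ℂ) : Continuous (rotation a) := by
  have hk := one_add_mul_conj_ne_zero a
  rw [OnePoint.continuous_iff]
  constructor
  · rw [rotation_infty, coclosedCompact_eq_cocompact, ← Metric.cobounded_eq_cocompact]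
    have h1 : Tendsto (fun w : ℂ => a + (1 + a * conj a) * (w - conj a)⁻¹)
        (Bornology.cobounded ℂ) (𝓝 (a + (1 + a * conj a) * 0)) :=
      (((tendsto_inv₀_cobounded (α := ℂ)).comp (tendsto_sub_const_cobounded (conj a))).const_mul _).const_add _
    rw [mul_zero, add_zero] at h1
    refine ((OnePoint.continuous_coe.tendsto a).comp h1).congr' ?_
    have : ∀ᶠ w in Bornology.cobounded ℂ, w ≠ conj a := by
      rw [Metric.cobounded_eq_cocompact]
      exact isCompact_singleton.compl_mem_cocompact
    filter_upwards [this] with w hw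
    rw [rotation_coe hw]
    rfl
  · rw [continuous_iff_continuousAt]
    intro w
    by_cases h : w = conj a
    · subst h
      rw [continuousAt_iff_punctured_nhds, rotation_conj]
      have h1 : Tendsto (fun w : ℂ => w - conj a) (𝓝[≠] (conj a)) (𝓝[≠] 0) := by
        refine tendsto_nhdsWithin_iff.mpr ⟨?_, ?_⟩
        · refine Tendsto.mono_left ?_ nhdsWithin_le_nhds
          have : Continuous fun w : ℂ => w - conj a := by fun_prop
          simpa using this.tendsto (conj a)
        · filter_upwards [self_mem_nhdsWithin] with w hw
          exact sub_ne_zero.mpr hw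
      have h2 : Tendsto (fun w : ℂ => a + (1 + a * conj a) * (w - conj a)⁻¹) (𝓝[≠] (conj a))
          (Bornology.cobounded ℂ) :=
        (tendsto_const_add_cobounded a).comp
          ((tendsto_mul_left_cobounded hk).comp (tendsto_inv₀_nhdsNE_zero.comp h1))
      rw [Metric.cobounded_eq_cocompact, ← coclosedCompact_eq_cocompact] at h2
      refine (OnePoint.tendsto_coe_infty.comp h2).congr' ?_
      filter_upwards [self_mem_nhdsWithin] with w hw
      rw [rotation_coe hw]
      rfl
    · have h' := sub_ne_zero.mpr h
      have h1 : ContinuousAt (fun w : ℂ => a + (1 + a * conj a) * (w - conj a)⁻¹) w :=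
        continuousAt_const.add (continuousAt_const.mul
          ((continuousAt_id.sub continuousAt_const).inv₀ h'))
      refine (OnePoint.continuous_coe.continuousAt.comp h1).congr ?_
      filter_upwards [isOpen_ne.mem_nhds h] with v hv
      rw [rotation_coe hv]
      rfl

/-- The rotation as a homeomorphism of the sphere. -/
def rotationHomeomorph (a : ℂ) : Sphere ≃ₜ Sphere where
  toFun := rotation a
  invFun := rotation (conj a)
  left_inv := rotation_rotation a
  right_inv p := by simpa using rotation_rotation (conj a) p
  continuous_toFun := continuous_rotation a
  continuous_invFun := continuous_rotation (conj a)

/-- The right side is the chordal distance from `w` to `∞`: the rotation preserves distances to that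
point. The core is `‖1 + a w‖² + ‖w - conj a‖² = (1 + ‖a‖²)(1 + ‖w‖²)`. -/
theorem chordalDist_rotation (a w : ℂ) :
    chordalDist (rotation a w) a = 2 / Real.sqrt (1 + ‖w‖ ^ 2) := by
  by_cases h : w = conj a
  · subst h
    rw [rotation_conj, Complex.norm_conj]
    rfl
  · rw [rotation_coe h]
    have h' : ‖w - conj a‖ ≠ 0 := norm_ne_zero_iff.mpr (sub_ne_zero.mpr h)
    set v : ℂ := a + (1 + a * conj a) * (w - conj a)⁻¹
    have hK : ‖1 + a * conj a‖ = 1 + ‖a‖ ^ 2 := by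
      rw [Complex.mul_conj, Complex.normSq_eq_norm_sq, ← Complex.ofReal_one, ← Complex.ofReal_add,
        Complex.norm_real, Real.norm_of_nonneg (by positivity)]
    have hv : v - a = (1 + a * conj a) * (w - conj a)⁻¹ := by simp [v]
    have hv' : ‖v‖ ^ 2 * ‖w - conj a‖ ^ 2 = ‖1 + a * w‖ ^ 2 := by
      rw [← mul_pow, ← norm_mul]
      congr 2
      have := sub_ne_zero.mpr h
      simp only [v]
      field_simp
      ring
    have hsum : (1 + ‖v‖ ^ 2) * ‖w - conj a‖ ^ 2 = (1 + ‖a‖ ^ 2) * (1 + ‖w‖ ^ 2) := by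
      rw [add_mul, hv']
      simp only [← Complex.normSq_eq_norm_sq, Complex.normSq_apply]
      simp
      ring
    have e1 : Real.sqrt (1 + ‖v‖ ^ 2) * ‖w - conj a‖ =
        Real.sqrt (1 + ‖a‖ ^ 2) * Real.sqrt (1 + ‖w‖ ^ 2) := by
      rw [← Real.sqrt_mul (by positivity), ← hsum, Real.sqrt_mul (by positivity),
        Real.sqrt_sq (norm_nonneg _)]
    change 2 * ‖v - a‖ / (Real.sqrt (1 + ‖v‖ ^ 2) * Real.sqrt (1 + ‖a‖ ^ 2)) = _
    rw [hv, norm_mul, norm_inv, hK]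
    have p1 : 0 < Real.sqrt (1 + ‖v‖ ^ 2) := by positivity
    have p2 : 0 < Real.sqrt (1 + ‖a‖ ^ 2) := by positivity
    have p3 : 0 < Real.sqrt (1 + ‖w‖ ^ 2) := by positivity
    have p4 : Real.sqrt (1 + ‖a‖ ^ 2) ^ 2 = 1 + ‖a‖ ^ 2 := Real.sq_sqrt (by positivity)
    generalize Real.sqrt (1 + ‖a‖ ^ 2) = s at *
    rw [← p4, div_eq_div_iff (by positivity) p3.ne']
    field_simp
    linear_combination -e1

theorem continuous_sphericalDist_left (b : Sphere) : Continuous fun p => sphericalDist p b := by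
  have hlim : Tendsto (fun z : ℂ => Real.sqrt (1 + ‖z‖ ^ 2)) (Bornology.cobounded ℂ) atTop := by
    refine tendsto_atTop_mono (fun z => ?_) (tendsto_norm_cobounded_atTop (E := ℂ))
    exact Real.le_sqrt_of_sq_le (by linarith)
  have hpos : ∀ z : ℂ, Real.sqrt (1 + ‖z‖ ^ 2) ≠ 0 := fun z => by positivity
  suffices h : Continuous fun p => chordalDist p b from
    continuous_const.mul (Real.continuous_arcsin.comp (h.div_const 2))
  rw [OnePoint.continuous_iff, coclosedCompact_eq_cocompact, ← Metric.cobounded_eq_cocompact]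
  induction b using OnePoint.rec with
  | infty =>
    change Tendsto (fun z : ℂ => 2 / Real.sqrt (1 + ‖z‖ ^ 2)) _ (𝓝 0) ∧
      Continuous fun z : ℂ => 2 / Real.sqrt (1 + ‖z‖ ^ 2)
    exact ⟨tendsto_const_nhds.div_atTop hlim, continuous_const.div (by fun_prop) hpos⟩
  | coe w =>
    change Tendsto (fun z : ℂ => 2 * ‖z - w‖ / (Real.sqrt (1 + ‖z‖ ^ 2) * Real.sqrt (1 + ‖w‖ ^ 2))) _
      (𝓝 (2 / Real.sqrt (1 + ‖w‖ ^ 2))) ∧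
      Continuous fun z : ℂ => 2 * ‖z - w‖ / (Real.sqrt (1 + ‖z‖ ^ 2) * Real.sqrt (1 + ‖w‖ ^ 2))
    refine ⟨?_, Continuous.div (by fun_prop) (by fun_prop) fun z => mul_ne_zero (hpos z) (hpos w)⟩
    have key : Tendsto (fun z : ℂ => ‖z - w‖ / Real.sqrt (1 + ‖z‖ ^ 2)) (Bornology.cobounded ℂ)
        (𝓝 1) := by
      refine tendsto_iff_norm_sub_tendsto_zero.mpr ?_
      refine squeeze_zero (fun _ => norm_nonneg _) (fun z => ?_)
        (tendsto_const_nhds (x := ‖w‖ + 1) |>.div_atTop hlim)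
      have h0 : 0 < Real.sqrt (1 + ‖z‖ ^ 2) := by positivity
      rw [div_sub_one h0.ne', norm_div, Real.norm_of_nonneg h0.le]
      gcongr
      have h1 : ‖z‖ ≤ Real.sqrt (1 + ‖z‖ ^ 2) := Real.le_sqrt_of_sq_le (by linarith)
      have h2 : Real.sqrt (1 + ‖z‖ ^ 2) ≤ 1 + ‖z‖ :=
        Real.sqrt_le_iff.mpr ⟨by positivity, by nlinarith [norm_nonneg z]⟩
      have h3 := norm_sub_norm_le z w
      have h4 := norm_sub_le z w
      rw [Real.norm_eq_abs, abs_le]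
      constructor <;> linarith [norm_nonneg w]
    have := (key.const_mul (2 / Real.sqrt (1 + ‖w‖ ^ 2)))
    rw [mul_one] at this
    refine this.congr fun z => ?_
    have := hpos z
    have := hpos w
    field_simp

theorem chordalDist_nonneg (p q : Sphere) : 0 ≤ chordalDist p q := by
  induction p using OnePoint.rec <;> induction q using OnePoint.rec
  · exact le_rfl
  · exact div_nonneg zero_le_two (Real.sqrt_nonneg _)
  · exact div_nonneg zero_le_two (Real.sqrt_nonneg _)
  · exact div_nonneg (by positivity) (by positivity)

theorem sphericalDist_nonneg (p q : Sphere) : 0 ≤ sphericalDist p q :=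
  mul_nonneg zero_le_two (Real.arcsin_nonneg.mpr (div_nonneg (chordalDist_nonneg p q) zero_le_two))

theorem eq_of_sphericalDist_eq_zero {p q : Sphere} (h : sphericalDist p q = 0) : p = q := by
  have h1 : chordalDist p q = 0 := by simpa [sphericalDist] using h
  have hpos : ∀ z : ℂ, 0 < Real.sqrt (1 + ‖z‖ ^ 2) := fun z => by positivity
  induction p using OnePoint.rec with
  | infty =>
    induction q using OnePoint.rec with
    | infty => rfl
    | coe w => exact absurd h1 (div_pos two_pos (hpos w)).ne'
  | coe z =>
    induction q using OnePoint.rec with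
    | infty => exact absurd h1 (div_pos two_pos (hpos z)).ne'
    | coe w =>
      change 2 * ‖z - w‖ / (Real.sqrt (1 + ‖z‖ ^ 2) * Real.sqrt (1 + ‖w‖ ^ 2)) = 0 at h1
      rw [div_eq_zero_iff, or_iff_left (mul_pos (hpos z) (hpos w)).ne'] at h1
      have : z = w := by simpa [sub_eq_zero] using h1
      rw [this]

/-- Small spherical balls are contained in a given neighbourhood of their centre. -/
theorem exists_sphericalBall_subset {W : Set Sphere} (hW : IsOpen W) {b : Sphere} (hb : b ∈ W) :
    ∃ r, 0 < r ∧ sphericalBall b r ⊆ W := by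
  rcases (Wᶜ).eq_empty_or_nonempty with h | h
  · exact ⟨1, one_pos, by rw [compl_empty_iff.mp h]; exact subset_univ _⟩
  · obtain ⟨p, hp, hmin⟩ := hW.isClosed_compl.isCompact.exists_isMinOn h
      (continuous_sphericalDist_left b).continuousOn
    refine ⟨sphericalDist p b, (sphericalDist_nonneg p b).lt_of_ne' fun h0 => ?_, fun q hq => ?_⟩
    · exact hp (eq_of_sphericalDist_eq_zero h0 ▸ hb)
    · by_contra hqW
      exact (show sphericalDist q b < _ from hq).not_ge (hmin hqW)

/-! ### Reduction to an entire function -/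

theorem analyticAt_inv_of_pole {f : ℂ → ℂ} {z : ℂ} (hf : MeromorphicNFAt f z)
    (hz : meromorphicOrderAt f z < 0) : AnalyticAt ℂ f⁻¹ z := by
  rw [← hf.inv.meromorphicOrderAt_nonneg_iff_analyticAt, meromorphicOrderAt_inv]
  lift meromorphicOrderAt f z to ℤ using hz.ne_top with m
  norm_cast at hz ⊢
  omega

theorem eq_zero_of_pole {f : ℂ → ℂ} {z : ℂ} (hf : MeromorphicNFAt f z)
    (hz : meromorphicOrderAt f z < 0) : f z = 0 := by
  by_contra h
  exact hz.ne (hf.meromorphicOrderAt_eq_zero_iff.mpr h)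

/-- A pole of order `m` is a zero of order `m` of `1 / f`, whose derivative has order `m - 1`. The
convention `f z = 0` at a pole gives `f⁻¹` its correct value there. -/
theorem deriv_inv_eq_zero_iff {f : ℂ → ℂ} {z : ℂ} (hf : MeromorphicNFAt f z)
    (hz : meromorphicOrderAt f z < 0) :
    deriv f⁻¹ z = 0 ↔ meromorphicOrderAt f z ≤ ((-2 : ℤ) : WithTop ℤ) := by
  have hu := analyticAt_inv_of_pole hf hz
  have h1 := hu.analyticOrderAt_deriv_add_one
  have h2 := hu.meromorphicOrderAt_eq
  have h3 := hu.deriv.analyticOrderAt_eq_zero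
  simp only [Pi.inv_apply, eq_zero_of_pole hf hz, inv_zero, sub_zero] at h1
  rw [meromorphicOrderAt_inv] at h2
  change _ = analyticOrderAt f⁻¹ z at h1
  rw [← h1] at h2
  lift meromorphicOrderAt f z to ℤ using hz.ne_top with m
  rw [← not_iff_not, ← ne_eq, ← h3]
  cases hn : analyticOrderAt (deriv f⁻¹) z with
  | top =>
    rw [hn] at h2
    exact absurd h2 (by simp)
  | coe k =>
    rw [hn] at h2
    have h3 : ((-m : ℤ) : WithTop ℤ) = (((k + 1 : ℕ) : ℤ) : WithTop ℤ) := h2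
    have h4 : -m = (k : ℤ) + 1 := by exact_mod_cast h3
    norm_cast
    omega

/-- A meromorphic function that omits `a` is a rotation of an entire function. -/
theorem exists_entire_model {f : ℂ → ℂ} (hf : IsTranscendentalMeromorphic f) {a : Sphere}
    (ha : IsOmittedValue f a) :
    ∃ (T : Sphere ≃ₜ Sphere) (g : ℂ → ℂ), Differentiable ℂ g ∧ (¬ ∃ c, ∀ z, g z = c) ∧
      (∀ z, sphereMap f z = T (g z)) ∧ T OnePoint.infty = a ∧
      (∀ z, IsCriticalPoint f z ↔ deriv g z = 0) ∧
      ∀ w : ℂ, chordalDist (T w) a = 2 / Real.sqrt (1 + ‖w‖ ^ 2) := by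
  have hNF : ∀ z, MeromorphicNFAt f z := fun z => hf.1 (mem_univ z)
  have hconst : ¬ ∃ c, ∀ z, f z = c := by
    rintro ⟨c, hc⟩
    exact hf.2 ⟨Polynomial.C c, 1, one_ne_zero, fun z _ => by simp [hc z]⟩
  suffices h : ∃ (T : Sphere ≃ₜ Sphere) (g : ℂ → ℂ), Differentiable ℂ g ∧
      (∀ z, sphereMap f z = T (g z)) ∧ T OnePoint.infty = a ∧
      (∀ z, IsCriticalPoint f z ↔ deriv g z = 0) ∧
      ∀ w : ℂ, chordalDist (T w) a = 2 / Real.sqrt (1 + ‖w‖ ^ 2) by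
    obtain ⟨T, g, hg, hT, hinf, hcr, hd⟩ := h
    refine ⟨T, g, hg, ?_, hT, hinf, hcr, hd⟩
    rintro ⟨c, hc⟩
    have hval : ∀ z, f z = (T c).elim 0 id := by
      intro z
      have h1 := hT z
      rw [hc z] at h1
      rw [← h1, sphereMap]
      split_ifs with h
      · rw [eq_zero_of_pole (hNF z) h]; rfl
      · rfl
    exact hconst ⟨_, hval⟩
  induction a using OnePoint.rec with
  | infty =>
    have hord : ∀ z, ¬ meromorphicOrderAt f z < 0 := fun z h => ha z (if_pos h)
    refine ⟨Homeomorph.refl _, f, fun z => ?_, fun z => if_neg (hord z), rfl, fun z => ?_,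
      fun w => rfl⟩
    · exact ((hNF z).meromorphicOrderAt_nonneg_iff_analyticAt.mp
        (not_lt.mp (hord z))).differentiableAt
    · refine or_iff_left (fun h => ?_) |>.trans (and_iff_right (not_lt.mp (hord z)))
      exact hord z (h.trans_lt (by norm_cast))
  | coe a =>
    classical
    have hk := one_add_mul_conj_ne_zero a
    set k : ℂ := 1 + a * conj a
    -- This is the inverse rotation applied to `f`; it sends `∞` to `conj a`, whence the value at
    -- poles.
    set g : ℂ → ℂ := fun z =>
      if meromorphicOrderAt f z < 0 then conj a else conj a + k * (f z - a)⁻¹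
    have hfa : ∀ z, ¬ meromorphicOrderAt f z < 0 → f z - a ≠ 0 := fun z hz h => by
      refine ha z ((if_neg hz).trans ?_)
      rw [sub_eq_zero.mp h]
    have hreg : ∀ z, ¬ meromorphicOrderAt f z < 0 →
        HasDerivAt g (k * (-deriv f z / (f z - a) ^ 2)) z := by
      intro z hz
      have hA : AnalyticAt ℂ f z :=
        (hNF z).meromorphicOrderAt_nonneg_iff_analyticAt.mp (not_lt.mp hz)
      have h1 : HasDerivAt (fun z => conj a + k * (f z - a)⁻¹)
          (k * (-deriv f z / (f z - a) ^ 2)) z :=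
        (((hA.differentiableAt.hasDerivAt.sub_const a).fun_inv (hfa z hz)).const_mul k).const_add _
      refine h1.congr_of_eventuallyEq ?_
      filter_upwards [hA.eventually_analyticAt] with y hy
      exact if_neg (not_lt.mpr hy.meromorphicOrderAt_nonneg)
    have hpole : ∀ z, meromorphicOrderAt f z < 0 → HasDerivAt g (k * deriv f⁻¹ z) z := by
      intro z hz
      have hu := (analyticAt_inv_of_pole (hNF z) hz).differentiableAt.hasDerivAt
      have hu0 : f⁻¹ z = 0 := by simp [eq_zero_of_pole (hNF z) hz]
      -- Near a pole `(f - a)⁻¹ = u / (1 - a u)` with `u = f⁻¹` analytic and zero at the pole.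
      have h1 : HasDerivAt (fun z => conj a + k * (f⁻¹ z / (1 - a * f⁻¹ z)))
          (k * ((deriv f⁻¹ z * (1 - a * f⁻¹ z) - f⁻¹ z * (-(a * deriv f⁻¹ z))) /
            (1 - a * f⁻¹ z) ^ 2)) z :=
        ((hu.fun_div ((hu.const_mul a).const_sub 1) (by simp [hu0])).const_mul k).const_add _
      simp only [hu0, mul_zero, sub_zero, mul_one, zero_mul, one_pow, div_one] at h1
      refine h1.congr_of_eventuallyEq ?_
      have hev : ∀ᶠ y in 𝓝[≠] z, g y = conj a + k * (f⁻¹ y / (1 - a * f⁻¹ y)) := by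
        filter_upwards [(hNF z).meromorphicAt.eventually_analyticAt,
          (meromorphicOrderAt_ne_top_iff_eventually_ne_zero (hNF z).meromorphicAt).mp hz.ne_top]
          with y hy hy0
        have hy1 : ¬ meromorphicOrderAt f y < 0 := not_lt.mpr hy.meromorphicOrderAt_nonneg
        have hy2 := hfa y hy1
        simp only [g, if_neg hy1, Pi.inv_apply]
        congr 2
        have hy3 : 1 - a * (f y)⁻¹ = (f y - a) * (f y)⁻¹ := by field_simp
        rw [hy3]
        field_simp
      rw [eventually_nhdsWithin_iff] at hev
      filter_upwards [hev] with y hy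
      by_cases hyz : y = z
      · rw [hyz, hu0]
        simp [g, hz]
      · exact hy hyz
    refine ⟨rotationHomeomorph a, g, fun z => ?_, fun z => ?_, rfl, fun z => ?_,
      chordalDist_rotation a⟩
    · by_cases hz : meromorphicOrderAt f z < 0
      · exact (hpole z hz).differentiableAt
      · exact (hreg z hz).differentiableAt
    · change _ = rotation a (g z)
      by_cases hz : meromorphicOrderAt f z < 0
      · simp only [sphereMap, g, if_pos hz]
        exact (rotation_conj a).symm
      · simp only [sphereMap, g, if_neg hz]
        have h2 : f z ≠ conj (conj a) := by
          rw [Complex.conj_conj]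
          exact sub_ne_zero.mp (hfa z hz)
        have h1 := rotation_rotation (conj a) (f z)
        rw [rotation_coe h2] at h1
        simp only [Complex.conj_conj] at h1
        rw [← h1, mul_comm (conj a) a]
    · by_cases hz : meromorphicOrderAt f z < 0
      · rw [(hpole z hz).deriv, mul_eq_zero, or_iff_right hk, deriv_inv_eq_zero_iff (hNF z) hz]
        exact or_iff_right fun h => hz.not_ge h.1
      · rw [(hreg z hz).deriv, mul_eq_zero, or_iff_right hk, div_eq_zero_iff, neg_eq_zero,
          or_iff_left (pow_ne_zero 2 (hfa z hz))]
        refine or_iff_left (fun h => ?_) |>.trans (and_iff_right (not_lt.mp hz))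
        exact hz (h.trans_lt (by norm_cast))

/-- Spherical balls around `a` correspond to complements of discs for the entire model. -/
theorem preimage_sphericalBall_eq {f g : ℂ → ℂ} {a : Sphere} {T : Sphere ≃ₜ Sphere}
    (hT : ∀ z, sphereMap f z = T (g z))
    (hd : ∀ w : ℂ, chordalDist (T w) a = 2 / Real.sqrt (1 + ‖w‖ ^ 2)) {R : ℝ} (hR : 0 ≤ R) :
    sphereMap f ⁻¹' sphericalBall a (2 * Real.arcsin (1 / Real.sqrt (1 + R ^ 2))) =
      {z | R < ‖g z‖} := by
  have hmem : ∀ x : ℝ, 1 / Real.sqrt (1 + x ^ 2) ∈ Icc (-1 : ℝ) 1 := fun x => by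
    have h1 : 1 ≤ Real.sqrt (1 + x ^ 2) := Real.one_le_sqrt.mpr (by nlinarith)
    refine ⟨by linarith [show 0 ≤ 1 / Real.sqrt (1 + x ^ 2) by positivity], ?_⟩
    exact (div_le_one (by positivity)).mpr h1
  ext z
  change 2 * Real.arcsin (chordalDist (sphereMap f z) a / 2) < _ ↔ R < ‖g z‖
  rw [hT, hd, div_right_comm, div_self two_ne_zero, mul_lt_mul_iff_right₀ two_pos,
    Real.strictMonoOn_arcsin.lt_iff_lt (hmem _) (hmem _),
    one_div_lt_one_div (by positivity) (by positivity), Real.sqrt_lt_sqrt_iff (by positivity),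
    add_lt_add_iff_left, sq_lt_sq₀ hR (norm_nonneg _)]

theorem tendsto_arcsin_radius :
    Tendsto (fun R : ℝ => 2 * Real.arcsin (1 / Real.sqrt (1 + R ^ 2))) atTop (𝓝 0) := by
  have h1 : Tendsto (fun R : ℝ => Real.sqrt (1 + R ^ 2)) atTop atTop :=
    tendsto_atTop_mono (fun R => Real.le_sqrt_of_sq_le (by simp)) tendsto_id
  have h2 : Tendsto (fun R : ℝ => 1 / Real.sqrt (1 + R ^ 2)) atTop (𝓝 0) :=
    tendsto_const_nhds.div_atTop h1
  simpa using ((Real.continuous_arcsin.tendsto 0).comp h2).const_mul 2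

/-- For a Baker omitted value, connected sets on which the entire model is bounded are bounded. -/
theorem IsBakerOmittedValue.boundedOnlyOnBounded {f g : ℂ → ℂ} {a : Sphere} {T : Sphere ≃ₜ Sphere}
    (ha : IsBakerOmittedValue f a) (hg : Differentiable ℂ g) (hc : ¬ ∃ c, ∀ z, g z = c)
    (hT : ∀ z, sphereMap f z = T (g z))
    (hd : ∀ w : ℂ, chordalDist (T w) a = 2 / Real.sqrt (1 + ‖w‖ ^ 2)) :
    BoundedOnlyOnBounded g := by
  obtain ⟨r₀, hr₀, hb⟩ := ha.2
  obtain ⟨R₀, hR₀⟩ := eventually_atTop.mp (tendsto_arcsin_radius.eventually_lt_const hr₀)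
  refine BakerOmitted.boundedOnlyOnBounded hg hc (R₀ := max R₀ 0) fun R hR C hC => ?_
  have hR0 : 0 ≤ R := (le_max_right _ _).trans hR.le
  refine hb (2 * Real.arcsin (1 / Real.sqrt (1 + R ^ 2))) ?_ (hR₀ R ((le_max_left _ _).trans hR.le)) C ?_
  · have : 0 < Real.arcsin (1 / Real.sqrt (1 + R ^ 2)) := Real.arcsin_pos.mpr (by positivity)
    positivity
  · rwa [preimage_sphericalBall_eq hT hd hR0]

/-! ### The assertions for the entire model -/

section Model

variable {f g : ℂ → ℂ} {a : Sphere} {T : Sphere ≃ₜ Sphere}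

theorem exists_coe_of_ne (hinf : T OnePoint.infty = a) {b : Sphere} (hb : b ≠ a) :
    ∃ β : ℂ, T (β : Sphere) = b := by
  have h : T.symm b ≠ OnePoint.infty := fun h => hb (by rw [← hinf, ← h, T.apply_symm_apply])
  obtain ⟨β, hβ⟩ := OnePoint.ne_infty_iff_exists.mp h
  exact ⟨β, by rw [hβ, T.apply_symm_apply]⟩

/-- The image of a disc in the sphere. -/
def discImage (T : Sphere ≃ₜ Sphere) (β : ℂ) (ε : ℝ) : Set Sphere :=
  T '' ((↑) '' Metric.ball β ε)

theorem isOpen_discImage (β : ℂ) (ε : ℝ) : IsOpen (discImage T β ε) :=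
  T.isOpenMap _ (OnePoint.isOpenMap_coe _ Metric.isOpen_ball)

theorem preimage_discImage (hT : ∀ z, sphereMap f z = T (g z)) (β : ℂ) (ε : ℝ) :
    sphereMap f ⁻¹' discImage T β ε = g ⁻¹' Metric.ball β ε := by
  ext z
  rw [mem_preimage, hT, discImage, T.injective.mem_set_image,
    OnePoint.coe_injective.mem_set_image, mem_preimage]

theorem isBounded_of_mapsTo_discImage (hB : BoundedOnlyOnBounded g)
    (hT : ∀ z, sphereMap f z = T (g z)) {β : ℂ} {ε : ℝ} {S : Set ℂ} (hS : IsPreconnected S)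
    (h : S ⊆ sphereMap f ⁻¹' discImage T β ε) : Bornology.IsBounded S := by
  rw [preimage_discImage hT] at h
  refine hB (‖β‖ + ε) S hS fun z hz => ?_
  have h1 : ‖g z - β‖ < ε := mem_ball_iff_norm.mp (h hz)
  linarith [norm_sub_norm_le (g z) β]

/-- If `b ≠ a`, a tail of the curve would be an unbounded connected set that `g` maps into a disc.
-/
theorem isAsymptoticValue_iff_of_model (hB : BoundedOnlyOnBounded g) (hg : Differentiable ℂ g)
    (hc : ¬ ∃ c, ∀ z, g z = c) (hT : ∀ z, sphereMap f z = T (g z)) (hinf : T OnePoint.infty = a)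
    (b : Sphere) : IsAsymptoticValue f b ↔ b = a := by
  constructor
  · rintro ⟨γ, hγ, hγ', hlim⟩
    by_contra hba
    obtain ⟨β, rfl⟩ := exists_coe_of_ne hinf hba
    have hmem : (T β : Sphere) ∈ discImage T β 1 :=
      mem_image_of_mem _ (mem_image_of_mem _ (Metric.mem_ball_self one_pos))
    obtain ⟨t₀, ht₀⟩ := eventually_atTop.mp
      (hlim.eventually ((isOpen_discImage β 1).mem_nhds hmem))
    set s := max t₀ 0
    have hS : IsPreconnected (γ '' Ici s) :=
      isPreconnected_Ici.image _ (hγ.mono (Ici_subset_Ici.mpr (le_max_right _ _)))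
    have hbd : Bornology.IsBounded (γ '' Ici s) := by
      refine isBounded_of_mapsTo_discImage (β := β) (ε := 1) hB hT hS ?_
      rintro _ ⟨t, ht, rfl⟩
      exact ht₀ t ((le_max_left _ _).trans ht)
    obtain ⟨t, ht, ht'⟩ := ((hγ'.eventually hbd.isCompact_closure.compl_mem_cocompact).and
      (eventually_ge_atTop s)).exists
    exact ht (subset_closure ⟨t, ht', rfl⟩)
  · rintro rfl
    obtain ⟨γ, hγ, hγ', hlim⟩ := hB.exists_curve hg hc
    refine ⟨γ, hγ.continuousOn, hγ', ?_⟩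
    rw [← coclosedCompact_eq_cocompact (X := ℂ)] at hlim
    simp only [hT]
    rw [← hinf]
    exact (T.continuous.tendsto _).comp (OnePoint.tendsto_coe_infty.comp hlim)

theorem continuous_sphereMap (hg : Differentiable ℂ g) (hT : ∀ z, sphereMap f z = T (g z)) :
    Continuous (sphereMap f) := by
  rw [funext hT]
  exact T.continuous.comp (OnePoint.continuous_coe.comp hg.continuous)

/-- Nested choices over values other than the Baker omitted value do not shrink to the
empty set. -/
theorem not_isTranscendentalSingularity (hB : BoundedOnlyOnBounded g) (hg : Differentiable ℂ g)
    (hT : ∀ z, sphereMap f z = T (g z)) (hinf : T OnePoint.infty = a) {b : Sphere} (hb : b ≠ a)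
    (U : ℝ → Set ℂ) : ¬ IsTranscendentalSingularity f b U := by
  rintro ⟨⟨hcomp, hmono⟩, hempty⟩
  have hF := continuous_sphereMap hg hT
  obtain ⟨β, rfl⟩ := exists_coe_of_ne hinf hb
  obtain ⟨r, hr, hsub⟩ := exists_sphericalBall_subset (isOpen_discImage (T := T) β 1)
    (mem_image_of_mem _ (mem_image_of_mem _ (Metric.mem_ball_self one_pos)))
  have hbd : Bornology.IsBounded (U r) := isBounded_of_mapsTo_discImage hB hT
    (hcomp r hr).isPreconnected ((hcomp r hr).subset.trans (preimage_mono hsub))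
  have hpos : ∀ n : ℕ, 0 < r / (n + 1) := fun n => by positivity
  have hle : ∀ {s t : ℝ}, 0 < s → s ≤ t → U s ⊆ U t := fun {s t} hs hst => by
    rcases hst.eq_or_lt with h | h
    · rw [h]
    · exact hmono s t hs h
  -- The nested closures are compact, so they share a point `p`. Then `f` takes the value `b` at
  -- `p`, and relative closedness of components puts `p` into every `U s`.
  obtain ⟨p, hp⟩ := IsCompact.nonempty_iInter_of_sequence_nonempty_isCompact_isClosed
    (fun n : ℕ => closure (U (r / (n + 1))))
    (fun n => closure_mono (hle (hpos _) (by push_cast; gcongr; linarith)))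
    (fun n => (hcomp _ (hpos n)).nonempty.closure) (by simpa using hbd.isCompact_closure)
    (fun n => isClosed_closure)
  rw [mem_iInter] at hp
  have hlim : Tendsto (fun n : ℕ => r / ((n : ℝ) + 1)) atTop (𝓝 0) :=
    tendsto_const_nhds.div_atTop
      (tendsto_atTop_add_const_right _ _ tendsto_natCast_atTop_atTop)
  have hdist : ∀ n : ℕ, sphericalDist (sphereMap f p) (T β) ≤ r / (n + 1) := fun n => by
    have hcl : IsClosed {z | sphericalDist (sphereMap f z) (T β) ≤ r / (n + 1)} :=
      isClosed_le ((continuous_sphericalDist_left _).comp hF) continuous_const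
    refine closure_minimal (fun z hz => ?_) hcl (hp n)
    exact le_of_lt (show sphericalDist (sphereMap f z) (T β) < _ from (hcomp _ (hpos n)).subset hz)
  have hzero : sphericalDist (sphereMap f p) (T β) = 0 :=
    le_antisymm (ge_of_tendsto' hlim hdist) (sphericalDist_nonneg _ _)
  have : p ∈ ⋂ s ∈ Ioi (0 : ℝ), U s := by
    refine mem_iInter₂.mpr fun s hs => ?_
    obtain ⟨n, hn⟩ := (hlim.eventually_lt_const (mem_Ioi.mp hs)).exists
    refine (hcomp s hs).closure_inter_subset ⟨closure_mono (hle (hpos n) hn.le) (hp n), ?_⟩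
    change sphericalDist (sphereMap f p) (T β) < s
    rwa [hzero]
  rw [hempty] at this
  exact this

theorem IsAlgebraicSingularity.isCriticalValue {b : Sphere} {U : ℝ → Set ℂ}
    (h : IsAlgebraicSingularity f b U) : IsCriticalValue f b := by
  obtain ⟨⟨hcomp, -⟩, z, hz, hcr⟩ := h
  have hmem : z ∈ ⋂ r ∈ Ioi (0 : ℝ), U r := hz ▸ mem_singleton z
  rw [mem_iInter₂] at hmem
  refine ⟨z, hcr, eq_of_sphericalDist_eq_zero (le_antisymm ?_ (sphericalDist_nonneg _ _))⟩
  exact le_of_forall_pos_lt_add fun r hr => by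
    rw [zero_add]
    exact (hcomp r hr).subset (hmem r hr)

/-- Off the closure, a small disc about `β` has no critical values of `g`; its preimage components
are bounded, hence mapped injectively. -/
theorem mem_closure_isCriticalValue (hB : BoundedOnlyOnBounded g) (hg : Differentiable ℂ g)
    (hT : ∀ z, sphereMap f z = T (g z)) (hinf : T OnePoint.infty = a)
    (hcr : ∀ z, IsCriticalPoint f z ↔ deriv g z = 0) {b : Sphere} (hb : b ≠ a)
    (h : IsSingularByNeighbourhoods f b) : b ∈ closure {c | IsCriticalValue f c} := by
  by_contra hcl
  obtain ⟨β, rfl⟩ := exists_coe_of_ne hinf hb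
  have hopen : IsOpen ((fun w : ℂ => T (w : Sphere)) ⁻¹' (closure {c | IsCriticalValue f c})ᶜ) :=
    isClosed_closure.isOpen_compl.preimage (T.continuous.comp OnePoint.continuous_coe)
  obtain ⟨ε, hε, hsub⟩ := Metric.isOpen_iff.mp hopen β hcl
  obtain ⟨V, hV, hninj⟩ := h (discImage T β ε) (isOpen_discImage β ε)
    (mem_image_of_mem _ (mem_image_of_mem _ (Metric.mem_ball_self hε)))
  have hbd := isBounded_of_mapsTo_discImage hB hT hV.isPreconnected hV.subset
  rw [preimage_discImage hT] at hV
  refine hninj fun p hp q hq hpq => ?_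
  refine injOn_of_component_ball hg hV hbd (fun z hz hz0 => ?_) hp hq ?_
  · exact hsub (hV.subset hz) (subset_closure ⟨z, (hcr z).mpr hz0, hT z⟩)
  · rw [hT, hT] at hpq
    exact OnePoint.coe_injective (T.injective hpq)

end Model

theorem isAsymptoticValue_iff {f : ℂ → ℂ} (hf : IsTranscendentalMeromorphic f) {a : Sphere}
    (ha : IsBakerOmittedValue f a) (b : Sphere) : IsAsymptoticValue f b ↔ b = a := by
  obtain ⟨T, g, hg, hc, hT, hinf, -, hd⟩ := exists_entire_model hf ha.1
  exact isAsymptoticValue_iff_of_model (ha.boundedOnlyOnBounded hg hc hT hd) hg hc hT hinf b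

end BakerOmitted

end

theorem mainTheorem2 (f : ℂ → ℂ) (hf : BakerOmitted.IsTranscendentalMeromorphic f)
    (a : BakerOmitted.Sphere) (ha : BakerOmitted.IsBakerOmittedValue f a) :
    (∀ b : BakerOmitted.Sphere, BakerOmitted.IsAsymptoticValue f b ↔ b = a) ∧
    (∀ b : BakerOmitted.Sphere, b ≠ a → BakerOmitted.HasSingularityOver f b →
      BakerOmitted.IsCriticalValue f b) ∧
    (∀ b : BakerOmitted.Sphere, b ≠ a → BakerOmitted.IsSingularByNeighbourhoods f b →
      b ∈ closure {c : BakerOmitted.Sphere | BakerOmitted.IsCriticalValue f c}) ∧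
    (∀ a' : BakerOmitted.Sphere, BakerOmitted.IsBakerOmittedValue f a' → a' = a) := by
  obtain ⟨T, g, hg, hc, hT, hinf, hcr, hd⟩ := BakerOmitted.exists_entire_model hf ha.1
  have hB := ha.boundedOnlyOnBounded hg hc hT hd
  refine ⟨BakerOmitted.isAsymptoticValue_iff hf ha, ?_, ?_, fun a' ha' => ?_⟩
  · rintro b hb ⟨U, hU | hU⟩
    · exact hU.isCriticalValue
    · exact absurd hU (BakerOmitted.not_isTranscendentalSingularity hB hg hT hinf hb U)
  · exact fun b hb h => BakerOmitted.mem_closure_isCriticalValue hB hg hT hinf hcr hb h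
  -- As a bov, `a'` is an asymptotic value, and `a` is the only one.
  · exact (BakerOmitted.isAsymptoticValue_iff hf ha a').mp
      ((BakerOmitted.isAsymptoticValue_iff hf ha' a').mpr rfl)
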